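/- Let $K$ be an algebraically closed field of characteristic zero, let $W_1,\dots,W_k$ be subgroups of the symmetric group $S_d$, and let $\chi_m\colon W_m\to K^\times$ be a one-dimensional character of $W_m$ for $m=1,\dots,k$. Symmetric functions are taken in the countable set of variables $x_0,x_1,x_2,\dots$, with power sums $p_s=\sum_{i\ge 0}x_i^s$, and $c_s(\sigma)$ is the number of cycles of length $s$ of $\sigma\in S_d$. The generalized cyclic index of a one-dimensional character $\chi\colon W\to K^\times$ of a subgroup $W\le S_d$ is $$Z(\chi)=Z(\chi;p_1,\dots,p_d)=\frac1{|W|}\sum_{\sigma\in W}\chi(\sigma)\,p_1^{c_1(\sigma)}\cdots p_d^{c_d(\sigma)} .$$ The characteristic of a generalized character $u$ of $S_d$ (an element of the additive group generated by the $K$-valued characters of the finite-dimensional $K$-linear representations of $S_d$) is $ch(u)=\frac1{d!}\sum_{\sigma\in S_d}u(\sigma)\,p_1^{c_1(\sigma)}\cdots p_d^{c_d(\sigma)}$, and the internal product $\ast$ of homogeneous symmetric functions of degree $d$ is defined by $ch(u)\ast ch(v)=ch(uv)$ for generalized characters $u,v$ of $S_d$; its identity element is $h_d=ch(1)$. For each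 $m$ let $I_m$ be a left transversal of $W_m$ in $S_d$, and let $I=I_1\times\cdots\times I_k$. For $\zeta\in S_d$ and $i=(i_1,\dots,i_k)\in I$ write $\zeta i_m=j_m\sigma_m$ with $j_m\in I_m$, $\sigma_m\in W_m$; then $\zeta\cdot i=(j_1,\dots,j_k)$ defines an action of $S_d$ on $I$, and we put $\beta_i(\zeta)=\chi_1(\sigma_1)\cdots\chi_k(\sigma_k)$. Let $T$ be a system of distinct representatives of the $S_d$-orbits in $I$. For $\omega=(\omega_1,\dots,\omega_k)\in T$ let $$W_\omega=\omega_1W_1\omega_1^{-1}\cap\dots\cap\omega_kW_k\omega_k^{-1},$$ and let $\psi_\omega$ be the restriction of $\beta_\omega$ to $W_\omega$, which is a one-dimensional character of $W_\omega$. Let $\mathbb N_0$ be the set of non-negative integers. The subgroups of $S_d$ act on $\mathbb N_0^d$ by permuting the components. Let $J(\mathbb N_0^d,\psi_\omega)$ be the set of those $W_\omega$-orbits in $\mathbb N_0^d$ which contain the maximal number $|W_\omega:\operatorname{Ker}\psi_\omega|$ of $\operatorname{Ker}\psi_\omega$-orbits, and let $$U(\chi_1,\dots,\chi_k)=\coprod_{\omega\in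 T}J(\mathbb N_0^d,\psi_\omega)$$ be their disjoint union. The weight $w(O)$ of an orbit $O$ is the monomial $x_{j_1}\cdots x_{j_d}$, where $(j_1,\dots,j_d)$ is any element of $O$. Theorem. Every monomial is the weight of only finitely many elements of $U(\chi_1,\dots,\chi_k)$, and the symmetric function $Z(\chi_1)\ast\cdots\ast Z(\chi_k)$ is the weighted inventory of $U(\chi_1,\dots,\chi_k)$: $$Z(\chi_1;p_1,\dots,p_d)\ast\cdots\ast Z(\chi_k;p_1,\dots,p_d)=\sum_{\omega\in T}\ \sum_{O\in J(\mathbb N_0^d,\psi_\omega)}w(O).$$ -/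

import Mathlib

open scoped BigOperators

namespace Redfield

noncomputable section

/-! ### Symmetric functions in the variables `x_0, x_1, x_2, …` and the internal product -/

/-- The number `c_s(σ)` of cycles of length `s` of `σ` (fixed points are the cycles of length 1). -/
def cycleCount {d : ℕ} (s : ℕ) (σ : Equiv.Perm (Fin d)) : ℕ :=
  σ.partition.parts.count s

open Classical in
/-- The power sum `p_s = ∑_{i ∈ ℕ} x_i ^ s`, used for `s ≥ 1` only. -/
def powerSum (K : Type*) [Field K] (s : ℕ) : MvPowerSeries ℕ K :=
  fun n => if ∃ i : ℕ, n = Finsupp.single i s then 1 else 0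

/-- `p_1 ^ c_1(σ) ⋯ p_d ^ c_d(σ)`. -/
def cycleMonomial (K : Type*) [Field K] {d : ℕ} (σ : Equiv.Perm (Fin d)) : MvPowerSeries ℕ K :=
  ∏ s ∈ Finset.Icc 1 d, powerSum K s ^ cycleCount s σ

/-- The group `R^d` of generalized characters of `S_d`: the additive group generated by the
characters of the finite-dimensional `K`-linear representations of `S_d`. -/
def genChar (K : Type*) [Field K] (d : ℕ) : AddSubgroup (Equiv.Perm (Fin d) → K) :=
  AddSubgroup.closure {u | ∃ (n : ℕ) (ρ : Representation K (Equiv.Perm (Fin d)) (Fin n → K)),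
    u = ρ.character}

/-- The characteristic map, `ch(u) = (1 / d!) ∑_{σ ∈ S_d} u(σ) p_1 ^ c_1(σ) ⋯ p_d ^ c_d(σ)`. -/
def ch {K : Type*} [Field K] {d : ℕ} (u : Equiv.Perm (Fin d) → K) : MvPowerSeries ℕ K :=
  (d.factorial : K)⁻¹ • ∑ σ : Equiv.Perm (Fin d), u σ • cycleMonomial K σ

/-- The internal product of symmetric functions of degree `d`: `ch u ∗ ch v = ch (u v)` for
generalized characters `u`, `v` of `S_d`. (On arguments that are not of the form `ch u` with `u` a
generalized character the value is immaterial.) -/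
def internalMul {K : Type*} [Field K] (d : ℕ) (f g : MvPowerSeries ℕ K) : MvPowerSeries ℕ K :=
  ch (Function.invFunOn (ch (d := d)) (genChar K d : Set (Equiv.Perm (Fin d) → K)) f *
    Function.invFunOn (ch (d := d)) (genChar K d : Set (Equiv.Perm (Fin d) → K)) g)

/-- `f_1 ∗ ⋯ ∗ f_k`; the identity element of the internal product is `h_d = ch 1`. -/
def internalProd {K : Type*} [Field K] (d : ℕ) {k : ℕ} (f : Fin k → MvPowerSeries ℕ K) :
    MvPowerSeries ℕ K :=
  (List.ofFn f).foldr (internalMul d) (ch (1 : Equiv.Perm (Fin d) → K))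

open Classical in
/-- The generalized cyclic index
`Z(χ; p_1, …, p_d) = |W|⁻¹ ∑_{σ ∈ W} χ(σ) p_1 ^ c_1(σ) ⋯ p_d ^ c_d(σ)`. -/
def cycleIndex {K : Type*} [Field K] {d : ℕ} {W : Subgroup (Equiv.Perm (Fin d))} (χ : W →* Kˣ) :
    MvPowerSeries ℕ K :=
  (Nat.card W : K)⁻¹ • ∑ σ : W, (χ σ : K) • cycleMonomial K (σ : Equiv.Perm (Fin d))

/-! ### The action of `S_d` on products of transversals and the characters `ψ_ω` -/

section Transversals

variable {d k : ℕ} {W : Fin k → Subgroup (Equiv.Perm (Fin d))}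
  {I : Fin k → Set (Equiv.Perm (Fin d))}

/-- The action of `ζ ∈ S_d` on `I_1 × ⋯ × I_k`: if `ζ i_m = j_m σ_m` with `j_m ∈ I_m` and
`σ_m ∈ W_m`, then `i = (i_1, …, i_k)` is sent to `(j_1, …, j_k)`. -/
def act (hI : ∀ m, Subgroup.IsComplement (I m) (W m : Set (Equiv.Perm (Fin d))))
    (ζ : Equiv.Perm (Fin d)) (i : ∀ m, I m) : ∀ m, I m :=
  fun m => ((hI m).equiv (ζ * (i m : Equiv.Perm (Fin d)))).1

/-- `β_i(ζ) = χ_1(σ_1) ⋯ χ_k(σ_k)`, where `ζ i_m = j_m σ_m` with `j_m ∈ I_m`, `σ_m ∈ W_m`. -/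
def beta {K : Type*} [Field K]
    (hI : ∀ m, Subgroup.IsComplement (I m) (W m : Set (Equiv.Perm (Fin d))))
    (χ : ∀ m, W m →* Kˣ) (i : ∀ m, I m) (ζ : Equiv.Perm (Fin d)) : Kˣ :=
  ∏ m, χ m ((hI m).equiv (ζ * (i m : Equiv.Perm (Fin d)))).2

/-- `T` is a system of distinct representatives of the `S_d`-orbits in `I_1 × ⋯ × I_k`. -/
def IsRepSystem (hI : ∀ m, Subgroup.IsComplement (I m) (W m : Set (Equiv.Perm (Fin d))))
    (T : Set (∀ m, I m)) : Prop :=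
  ∀ i : ∀ m, I m, ∃! ω : ∀ m, I m, ω ∈ T ∧ ∃ ζ : Equiv.Perm (Fin d), act hI ζ ω = i

/-- The intersection `ω_1 W_1 ω_1⁻¹ ∩ ⋯ ∩ ω_k W_k ω_k⁻¹`. -/
def stab (W : Fin k → Subgroup (Equiv.Perm (Fin d))) (ω : ∀ m, I m) :
    Subgroup (Equiv.Perm (Fin d)) :=
  ⨅ m, (W m).map (MulAut.conj (ω m : Equiv.Perm (Fin d))).toMonoidHom

theorem conj_mem_of_mem_stab {ω : ∀ m, I m} {ζ : Equiv.Perm (Fin d)} (hζ : ζ ∈ stab W ω)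
    (m : Fin k) :
    (ω m : Equiv.Perm (Fin d))⁻¹ * ζ * (ω m : Equiv.Perm (Fin d)) ∈ W m := by
  obtain ⟨w, hw, rfl⟩ := Subgroup.mem_map.1 (Subgroup.mem_iInf.1 hζ m)
  simpa [mul_assoc] using hw

theorem equiv_of_mem_stab
    (hI : ∀ m, Subgroup.IsComplement (I m) (W m : Set (Equiv.Perm (Fin d))))
    {ω : ∀ m, I m} {ζ : Equiv.Perm (Fin d)} (hζ : ζ ∈ stab W ω) (m : Fin k) :
    (hI m).equiv (ζ * (ω m : Equiv.Perm (Fin d))) =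
      (ω m, ⟨_, conj_mem_of_mem_stab hζ m⟩) := by
  rw [← Equiv.eq_symm_apply, Subgroup.IsComplement.equiv_symm_apply]
  simp [mul_assoc]

/-- The one-dimensional character `ψ_ω` of `ω_1 W_1 ω_1⁻¹ ∩ ⋯ ∩ ω_k W_k ω_k⁻¹`, the restriction
of `β_ω`. -/
def psi {K : Type*} [Field K]
    (hI : ∀ m, Subgroup.IsComplement (I m) (W m : Set (Equiv.Perm (Fin d))))
    (χ : ∀ m, W m →* Kˣ) (ω : ∀ m, I m) : stab W ω →* Kˣ :=
  MonoidHom.mk' (fun ζ => beta hI χ ω (ζ : Equiv.Perm (Fin d))) <| by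
    intro a b
    unfold beta
    rw [← Finset.prod_mul_distrib]
    refine Finset.prod_congr rfl fun m _ => ?_
    rw [equiv_of_mem_stab hI a.2 m, equiv_of_mem_stab hI b.2 m, equiv_of_mem_stab hI (a * b).2 m,
      ← map_mul]
    congr 1
    ext1
    simp [mul_assoc]

end Transversals

/-! ### Orbits on `ℕ^d`, weights and inventories -/

/-- The orbit of `x ∈ ℕ^d` under a group `H ≤ S_d` that permutes the components. -/
def wordOrbit {d : ℕ} (H : Subgroup (Equiv.Perm (Fin d))) (x : Fin d → ℕ) : Set (Fin d → ℕ) :=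
  Set.range fun σ : H => fun a : Fin d => x ((σ : Equiv.Perm (Fin d))⁻¹ a)

/-- The set `J(ℕ^d, ψ)` of the `H`-orbits in `ℕ^d` that contain exactly `|H : Ker ψ|` orbits of
`Ker ψ`, the maximal possible number. -/
def maxOrbits {K : Type*} [Field K] {d : ℕ} {H : Subgroup (Equiv.Perm (Fin d))} (ψ : H →* Kˣ) :
    Set (Set (Fin d → ℕ)) :=
  {O | (∃ x, O = wordOrbit H x) ∧
    {P | P ⊆ O ∧ ∃ y, P = wordOrbit (ψ.ker.map H.subtype) y}.ncard = ψ.ker.index}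

/-- `U(χ_1, …, χ_k)`, the disjoint union of the sets `J(ℕ^d, ψ_ω)` over `ω ∈ T`. -/
def U {K : Type*} [Field K] {d k : ℕ} {W : Fin k → Subgroup (Equiv.Perm (Fin d))}
    {I : Fin k → Set (Equiv.Perm (Fin d))}
    (hI : ∀ m, Subgroup.IsComplement (I m) (W m : Set (Equiv.Perm (Fin d))))
    (χ : ∀ m, W m →* Kˣ) (T : Set (∀ m, I m)) : Type :=
  Σ ω : T, maxOrbits (psi hI χ (ω : ∀ m, I m))

/-- The exponent of the monomial `x_{j_1} ⋯ x_{j_d}` of `j = (j_1, …, j_d) ∈ ℕ^d`. -/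
def content {d : ℕ} (j : Fin d → ℕ) : ℕ →₀ ℕ :=
  ∑ a, Finsupp.single (j a) 1

open Classical in
/-- The exponent of the weight `x_{j_1} ⋯ x_{j_d}` of an orbit, where `j` is any of its elements
(all of them have the same content). -/
def orbitWeight {d : ℕ} (O : Set (Fin d → ℕ)) : ℕ →₀ ℕ :=
  if h : O.Nonempty then content h.some else 0

/-- The exponent of the weight of an element of `U(χ_1, …, χ_k)`. -/
def U.weight {K : Type*} [Field K] {d k : ℕ} {W : Fin k → Subgroup (Equiv.Perm (Fin d))}
    {I : Fin k → Set (Equiv.Perm (Fin d))}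
    {hI : ∀ m, Subgroup.IsComplement (I m) (W m : Set (Equiv.Perm (Fin d)))}
    {χ : ∀ m, W m →* Kˣ} {T : Set (∀ m, I m)} (u : U hI χ T) : ℕ →₀ ℕ :=
  orbitWeight (u.2 : Set (Fin d → ℕ))

/-- The weighted inventory `∑_{u ∈ A} x ^ w(u)` of a set `A` whose elements have monomial weights,
where every monomial is the weight of finitely many elements of `A`. -/
def inventory (K : Type*) [Field K] {A : Type*} (w : A → ℕ →₀ ℕ) : MvPowerSeries ℕ K :=
  fun n => (Nat.card {u : A // w u = n} : K)

end

end Redfield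

/-! The series Z(χ_m) is the characteristic of the character of S_d induced from χ_m
(`cycleIndex_eq_ch`). Since `ch` is injective on class functions (`eq_zero_of_ch_eq_zero`), the
internal product becomes the pointwise product of these induced characters. In the tensor product of
the induced representations, S_d permutes the basis I_1 × ⋯ × I_k up to the scalars β_i(ζ). As in
Mackey's formula, the orbit of ω contributes the character induced from ψ_ω, so the internal product
is ∑_ω Z(ψ_ω) (`ch_prod_indChar`).

It remains to read off the coefficients of a single Z(ψ). The coefficient of a monomial in
p_1^{c_1(σ)} ⋯ p_d^{c_d(σ)} counts the words of that content fixed by σ. Exchanging sums leaves ∑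
ψ(σ) over the stabilizer of each word, which vanishes unless ψ is trivial there. Thus Burnside
counting sees exactly the orbits with stabilizers inside Ker ψ, and these are the orbits that split
into |H : Ker ψ| orbits of Ker ψ. -/

namespace Redfield

noncomputable section

/-! ### Cycles of a permutation as equivalence classes -/

open Classical in
/-- The set of elements in the class `q` of a setoid on a finite type. -/
def classFinset {α : Type*} [Fintype α] {s : Setoid α} (q : Quotient s) : Finset α :=
  Finset.univ.filter fun a => Quotient.mk s a = q

theorem mem_classFinset {α : Type*} [Fintype α] {s : Setoid α} {q : Quotient s} {a : α} :
    a ∈ classFinset q ↔ Quotient.mk s a = q := by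
  simp [classFinset]

theorem classFinset_injective {α : Type*} [Fintype α] {s : Setoid α} :
    Function.Injective (classFinset (s := s)) := by
  intro p q h
  induction p using Quotient.inductionOn with
  | h a => rw [← mem_classFinset, ← h, mem_classFinset]

theorem card_classFinset_pos {α : Type*} [Fintype α] {s : Setoid α} (q : Quotient s) :
    0 < (classFinset q).card := by
  induction q using Quotient.inductionOn with
  | h a => exact Finset.card_pos.2 ⟨a, mem_classFinset.2 rfl⟩

theorem classFinset_mk_of_mem_support {α : Type*} [Fintype α] [DecidableEq α]
    {σ : Equiv.Perm α} {a : α} (ha : a ∈ σ.support) :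
    classFinset (Quotient.mk (Equiv.Perm.SameCycle.setoid σ) a) = (σ.cycleOf a).support := by
  ext b
  rw [mem_classFinset, Equiv.Perm.mem_support_cycleOf_iff' (Equiv.Perm.mem_support.1 ha),
    Quotient.eq]
  exact Equiv.Perm.sameCycle_comm

theorem classFinset_mk_of_notMem_support {α : Type*} [Fintype α] [DecidableEq α]
    {σ : Equiv.Perm α} {a : α} (ha : a ∉ σ.support) :
    classFinset (Quotient.mk (Equiv.Perm.SameCycle.setoid σ) a) = {a} := by
  ext b
  rw [mem_classFinset, Quotient.eq, Finset.mem_singleton]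
  constructor
  · intro h
    have h' : σ.SameCycle b a := h
    obtain ⟨i, hi⟩ := h'.symm
    rw [← hi, Equiv.Perm.zpow_apply_eq_self_of_apply_eq_self (by simpa using ha)]
  · rintro rfl
    exact Equiv.Perm.SameCycle.refl _ _

open Classical in
/-- The parts of the cycle partition of `σ` are the sizes of the classes of lying on the same
cycle. -/
theorem parts_partition_eq_map_card {α : Type*} [Fintype α] [DecidableEq α] (σ : Equiv.Perm α) :
    σ.partition.parts = (Finset.univ : Finset (Quotient (Equiv.Perm.SameCycle.setoid σ))).val.map
      fun q => (classFinset q).card := by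
  have hF : (Finset.univ : Finset (Quotient (Equiv.Perm.SameCycle.setoid σ))).image classFinset =
      σ.cycleFactorsFinset.image Equiv.Perm.support ∪
        σ.supportᶜ.image (fun a => ({a} : Finset α)) := by
    ext t
    simp only [Finset.mem_image, Finset.mem_univ, true_and, Finset.mem_union, Finset.mem_compl]
    constructor
    · rintro ⟨q, rfl⟩
      induction q using Quotient.inductionOn with
      | h a =>
        by_cases ha : a ∈ σ.support
        · left
          refine ⟨σ.cycleOf a, Equiv.Perm.cycleOf_mem_cycleFactorsFinset_iff.2 ha, ?_⟩
          rw [classFinset_mk_of_mem_support ha]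
        · exact Or.inr ⟨a, ha, (classFinset_mk_of_notMem_support ha).symm⟩
    · rintro (⟨c, hc, rfl⟩ | ⟨a, ha, rfl⟩)
      · obtain ⟨a, ha⟩ := (Equiv.Perm.mem_cycleFactorsFinset_iff.1 hc).1.nonempty_support
        have hca : c = σ.cycleOf a := Equiv.Perm.cycle_is_cycleOf ha hc
        have ha' := Equiv.Perm.mem_cycleFactorsFinset_support_le hc ha
        refine ⟨Quotient.mk _ a, ?_⟩
        rw [classFinset_mk_of_mem_support ha', hca]
      · exact ⟨Quotient.mk _ a, classFinset_mk_of_notMem_support ha⟩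
  have hdisj : Disjoint (σ.cycleFactorsFinset.image Equiv.Perm.support)
      (σ.supportᶜ.image (fun a => ({a} : Finset α))) := by
    rw [Finset.disjoint_left]
    rintro t ht ht'
    obtain ⟨c, hc, rfl⟩ := Finset.mem_image.1 ht
    obtain ⟨a, ha, hac⟩ := Finset.mem_image.1 ht'
    have := (Equiv.Perm.mem_cycleFactorsFinset_iff.1 hc).1.two_le_card_support
    rw [← hac] at this
    simp at this
  have hinj : Set.InjOn Equiv.Perm.support (σ.cycleFactorsFinset : Set (Equiv.Perm α)) := by
    intro c hc c' hc' h
    obtain ⟨a, ha⟩ := (Equiv.Perm.mem_cycleFactorsFinset_iff.1 hc).1.nonempty_support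
    rw [Equiv.Perm.cycle_is_cycleOf ha hc, Equiv.Perm.cycle_is_cycleOf (h ▸ ha) hc']
  have hmap : (Finset.univ : Finset (Quotient (Equiv.Perm.SameCycle.setoid σ))).val.map
      (fun q => (classFinset q).card) =
      ((Finset.univ : Finset (Quotient (Equiv.Perm.SameCycle.setoid σ))).image
        classFinset).val.map Finset.card := by
    rw [Finset.image_val_of_injOn classFinset_injective.injOn, Multiset.map_map]
    rfl
  -- The partition is the cycle type padded with a part 1 for each fixed point, matching the
  -- nontrivial cycles and the singleton classes respectively.
  rw [hmap, hF, ← Finset.disjUnion_eq_union _ _ hdisj, Finset.disjUnion_val, Multiset.map_add,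
    Finset.image_val_of_injOn hinj, Finset.image_val_of_injOn Finset.singleton_injective.injOn,
    Multiset.map_map, Multiset.map_map, Equiv.Perm.parts_partition, Equiv.Perm.cycleType_def]
  congr 1
  simp [Finset.card_compl]

/-- Every part of the partition lies between 1 and d, so grouping equal cycle lengths loses no
factor. One factor per cycle is the form in which coefficients can be expanded. -/
theorem cycleMonomial_eq_prod_quotient (K : Type*) [Field K] {d : ℕ} (σ : Equiv.Perm (Fin d))
    [Fintype (Quotient (Equiv.Perm.SameCycle.setoid σ))] :
    cycleMonomial K σ =
      ∏ q : Quotient (Equiv.Perm.SameCycle.setoid σ), powerSum K (classFinset q).card := by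
  have h : (σ.partition.parts.map (powerSum K)).prod = cycleMonomial K σ := by
    rw [Finset.prod_multiset_map_count]
    refine Finset.prod_subset ?_ ?_
    · intro s hs
      rw [Multiset.mem_toFinset] at hs
      have hle := Multiset.single_le_sum (fun _ _ => Nat.zero_le _) s hs
      rw [σ.partition.parts_sum, Fintype.card_fin] at hle
      exact Finset.mem_Icc.2 ⟨σ.partition.parts_pos hs, hle⟩
    · intro s _ hs
      rw [Multiset.mem_toFinset, ← Multiset.count_eq_zero] at hs
      rw [hs, pow_zero]
  rw [← h, parts_partition_eq_map_card, Multiset.map_map]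
  refine Finset.prod_congr ?_ fun _ _ => rfl
  ext; simp

/-! ### Words, contents and the coefficients of cycle monomials -/

theorem content_apply_pos {d : ℕ} (x : Fin d → ℕ) (a : Fin d) : 0 < content x (x a) := by
  rw [content, Finsupp.finsetSum_apply]
  exact Finset.sum_pos' (fun _ _ => Nat.zero_le _) ⟨a, Finset.mem_univ _, by simp⟩

theorem finite_content_eq {d : ℕ} (n : ℕ →₀ ℕ) : {x : Fin d → ℕ | content x = n}.Finite := by
  refine (Set.Finite.pi (t := fun _ : Fin d => (n.support : Set ℕ))
    fun _ => n.support.finite_toSet).subset ?_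
  rintro x rfl a -
  exact Finsupp.mem_support_iff.2 (content_apply_pos x a).ne'

/-- The finite set of the words `x` of length `d` with content `n`. -/
def words (d : ℕ) (n : ℕ →₀ ℕ) : Finset (Fin d → ℕ) := (finite_content_eq n).toFinset

theorem mem_words {d : ℕ} {n : ℕ →₀ ℕ} {x : Fin d → ℕ} : x ∈ words d n ↔ content x = n := by
  simp [words]

theorem content_comp_perm {d : ℕ} (x : Fin d → ℕ) (σ : Equiv.Perm (Fin d)) :
    content (fun a => x (σ a)) = content x := by
  simp only [content]
  exact Equiv.sum_comp σ (fun a => Finsupp.single (x a) 1)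

theorem content_lift {d : ℕ} {s : Setoid (Fin d)} [Fintype (Quotient s)] (y : Quotient s → ℕ) :
    content (fun a => y (Quotient.mk s a)) =
      ∑ q, Finsupp.single (y q) (classFinset q).card := by
  classical
  rw [content, ← Finset.sum_fiberwise (Finset.univ) (fun a : Fin d => Quotient.mk s a)]
  refine Finset.sum_congr rfl fun q _ => ?_
  rw [Finset.sum_congr rfl (g := fun _ => Finsupp.single (y q) 1)
    (fun a ha => by rw [(Finset.mem_filter.1 ha).2])]
  rw [Finset.sum_const, Finsupp.smul_single, smul_eq_mul, mul_one]
  congr!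

theorem coeff_powerSum (K : Type*) [Field K] (s : ℕ) (n : ℕ →₀ ℕ)
    [Decidable (∃ i : ℕ, n = Finsupp.single i s)] :
    MvPowerSeries.coeff n (powerSum K s) = if ∃ i : ℕ, n = Finsupp.single i s then 1 else 0 := by
  rw [MvPowerSeries.coeff_apply, powerSum]
  congr

theorem eq_of_sameCycle {α β : Type*} [Finite α] {σ : Equiv.Perm α} {x : α → β}
    (hx : ∀ a, x (σ a) = x a) {a b : α} (hab : σ.SameCycle a b) : x a = x b := by
  obtain ⟨i, -, -, hi⟩ := hab.exists_pow_eq''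
  rw [← hi]
  clear hi
  induction i with
  | zero => simp
  | succ i ih => rw [pow_succ', Equiv.Perm.mul_apply, hx, ih]

open Classical in
/-- The coefficients of `p_1 ^ c_1(σ) ⋯ p_d ^ c_d(σ)` count the words fixed by `σ`. -/
theorem coeff_cycleMonomial (K : Type*) [Field K] {d : ℕ} (σ : Equiv.Perm (Fin d))
    (n : ℕ →₀ ℕ) :
    MvPowerSeries.coeff n (cycleMonomial K σ) =
      (((words d n).filter fun x => ∀ a, x (σ a) = x a).card : K) := by
  rw [cycleMonomial_eq_prod_quotient, MvPowerSeries.coeff_prod]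
  simp only [coeff_powerSum, Finset.prod_ite_zero, Finset.prod_const_one]
  rw [Finset.sum_boole]
  congr 1
  symm
  -- A word fixed by σ is constant on cycles. Its letter on a cycle selects one term of the
  -- corresponding power sum.
  refine Finset.card_bij (fun x _ => Finsupp.equivFunOnFinite.symm fun q =>
    Finsupp.single (x q.out) (classFinset q).card) ?_ ?_ ?_
  · intro x hx
    obtain ⟨hxn, hx⟩ := Finset.mem_filter.1 hx
    rw [mem_words] at hxn
    refine Finset.mem_filter.2 ⟨?_, ?_⟩
    · rw [Finset.mem_finsuppAntidiag]
      refine ⟨?_, Finset.subset_univ _⟩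
      have := content_lift (s := Equiv.Perm.SameCycle.setoid σ) (fun q => x q.out)
      rw [← hxn]
      simp only [Finsupp.equivFunOnFinite_symm_apply_apply]
      rw [← this]
      congr 1
      funext a
      exact eq_of_sameCycle hx (Quotient.mk_out (s := Equiv.Perm.SameCycle.setoid σ) a)
    · intro q _
      exact ⟨x q.out, rfl⟩
  · intro x hx x' hx' h
    have hx := (Finset.mem_filter.1 hx).2
    have hx' := (Finset.mem_filter.1 hx').2
    have h := Finsupp.equivFunOnFinite.symm.injective h
    funext a
    have ha := congrFun h (Quotient.mk _ a)
    -- The exponent determines the letter only because cycle lengths are nonzero.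
    have ha' := (Finsupp.single_left_inj (card_classFinset_pos _).ne').1 ha
    have hout := Quotient.mk_out (s := Equiv.Perm.SameCycle.setoid σ) a
    rw [← eq_of_sameCycle hx hout, ← eq_of_sameCycle hx' hout, ha']
  · intro l hl
    obtain ⟨hl, hy⟩ := Finset.mem_filter.1 hl
    rw [Finset.mem_finsuppAntidiag] at hl
    choose! y hy using fun q => hy q (Finset.mem_univ q)
    refine ⟨fun a => y (Quotient.mk _ a), Finset.mem_filter.2 ⟨?_, ?_⟩, ?_⟩
    · rw [mem_words, content_lift, ← hl.1]
      exact Finset.sum_congr rfl fun q _ => (hy q).symm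
    · intro a
      refine congrArg y ?_
      exact Quotient.sound (s := Equiv.Perm.SameCycle.setoid σ)
        (Equiv.Perm.sameCycle_apply_left.2 (Equiv.Perm.SameCycle.refl _ _))
    · ext1 q
      simp [hy q]

open Classical in
theorem cycleMonomial_eq_of_isConj (K : Type*) [Field K] {d : ℕ} {σ τ : Equiv.Perm (Fin d)}
    (h : IsConj σ τ) : cycleMonomial K σ = cycleMonomial K τ := by
  have h := Equiv.Perm.partition_eq_of_isConj.1 h
  simp only [cycleMonomial, cycleCount]
  congr! 5

/-! ### Injectivity of the characteristic map -/

theorem exists_perm_of_content_eq {d : ℕ} {x y : Fin d → ℕ} (h : content x = content y) :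
    ∃ σ : Equiv.Perm (Fin d), x = y ∘ σ := by
  have hcard : ∀ z : Fin d → ℕ, ∀ c, content z c = Fintype.card {a // z a = c} := by
    intro z c
    rw [content, Finsupp.finsetSum_apply, Fintype.card_subtype, Finset.card_filter]
    simp only [Finsupp.single_apply]
  have e : ∀ c, {a // x a = c} ≃ {a // y a = c} := fun c =>
    Fintype.equivOfCardEq (by rw [← hcard, ← hcard, h])
  exact ⟨Equiv.ofFiberEquiv e, funext fun a => (Equiv.ofFiberEquiv_map e a).symm⟩

open Classical in
theorem coeff_ch {K : Type*} [Field K] {d : ℕ} (u : Equiv.Perm (Fin d) → K) (n : ℕ →₀ ℕ) :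
    MvPowerSeries.coeff n (ch u) = (d.factorial : K)⁻¹ *
      ∑ x ∈ words d n, ∑ σ : Equiv.Perm (Fin d) with ∀ a, x (σ a) = x a, u σ := by
  simp only [ch, map_smul, map_sum, coeff_cycleMonomial, smul_eq_mul, Finset.card_filter,
    Nat.cast_sum, Finset.mul_sum, Finset.sum_filter]
  rw [Finset.sum_comm]
  simp

/-- `u` is constant on conjugacy classes. -/
def IsClassFun {G β : Type*} [Group G] (u : G → β) : Prop := ∀ g h, u (h * g * h⁻¹) = u g

-- Words of equal content have conjugate stabilizers, so a class function has the same sum over each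
-- of them. A coefficient of `ch u` is therefore a nonzero multiple of one such sum.
open Classical in
theorem sum_fixing_eq_zero {K : Type*} [Field K] [CharZero K] {d : ℕ}
    {u : Equiv.Perm (Fin d) → K} (hu : IsClassFun u) (h : ch u = 0) (x : Fin d → ℕ) :
    ∑ σ : Equiv.Perm (Fin d) with ∀ a, x (σ a) = x a, u σ = 0 := by
  have hn := congrArg (MvPowerSeries.coeff (content x)) h
  rw [coeff_ch, map_zero] at hn
  have hd : (d.factorial : K)⁻¹ ≠ 0 := inv_ne_zero (by exact_mod_cast d.factorial_ne_zero)
  have hn := (mul_eq_zero.1 hn).resolve_left hd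
  rw [Finset.sum_congr rfl (g := fun _ => ∑ σ : Equiv.Perm (Fin d) with ∀ a, x (σ a) = x a, u σ),
    Finset.sum_const, nsmul_eq_mul] at hn
  · refine (mul_eq_zero.1 hn).resolve_left ?_
    exact_mod_cast (Finset.card_pos.2 ⟨x, mem_words.2 rfl⟩).ne'
  · intro y hy
    obtain ⟨τ, rfl⟩ := exists_perm_of_content_eq (mem_words.1 hy)
    rw [Finset.sum_filter, Finset.sum_filter]
    refine Fintype.sum_equiv (MulAut.conj τ).toEquiv _ _ fun σ => ?_
    simp only [MulEquiv.toEquiv_eq_coe, MulEquiv.coe_toEquiv, MulAut.conj_apply, hu σ τ]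
    refine if_congr ?_ rfl rfl
    constructor
    · intro h a
      simpa using h (τ⁻¹ a)
    · intro h a
      simpa using h (τ a)

theorem isConj_of_sameCycle_setoid_eq {α : Type*} [Fintype α] [DecidableEq α]
    {σ τ : Equiv.Perm α}
    (h : Equiv.Perm.SameCycle.setoid σ = Equiv.Perm.SameCycle.setoid τ) : IsConj σ τ := by
  classical
  rw [Equiv.Perm.partition_eq_of_isConj, Nat.Partition.ext_iff, parts_partition_eq_map_card,
    parts_partition_eq_map_card, h]

/-- The characteristic map is injective on class functions. -/
theorem eq_zero_of_ch_eq_zero {K : Type*} [Field K] [CharZero K] {d : ℕ}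
    {u : Equiv.Perm (Fin d) → K} (hu : IsClassFun u) (h : ch u = 0) : u = 0 := by
  classical
  have : Finite (Setoid (Fin d)) :=
    Finite.of_injective (fun s : Setoid (Fin d) => (fun a b => s a b)) fun s t hst =>
      Setoid.ext fun a b => by rw [show s a b = t a b from congrFun (congrFun hst a) b]
  -- Induction on the partition into cycles, finer partitions first.
  suffices H : ∀ s : Setoid (Fin d), ∀ σ, Equiv.Perm.SameCycle.setoid σ = s → u σ = 0 by
    funext σ
    exact H _ σ rfl
  intro s
  induction s using WellFoundedLT.induction with
  | ind s ih =>
  rintro τ rfl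
  -- Labelling each point by a representative of its cycle gives a word fixed exactly by the
  -- permutations whose cycles refine those of τ.
  set x : Fin d → ℕ := fun a => (Quotient.mk (Equiv.Perm.SameCycle.setoid τ) a).out with hx
  have hx_iff : ∀ a b, x a = x b ↔ τ.SameCycle a b := by
    intro a b
    rw [hx]
    simp only [Fin.val_inj, Quotient.out_inj, Quotient.eq]
    rfl
  -- Strictly finer terms vanish by induction. The others are conjugate to τ, leaving a positive
  -- multiple of `u τ`.
  have hsum := sum_fixing_eq_zero hu h x
  rw [← Finset.sum_filter_add_sum_filter_not _
    (fun σ => Equiv.Perm.SameCycle.setoid σ = Equiv.Perm.SameCycle.setoid τ)] at hsum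
  rw [Finset.sum_eq_zero (s := Finset.filter (fun σ => ¬ _) _), add_zero,
    Finset.sum_congr rfl (g := fun _ => u τ), Finset.sum_const, nsmul_eq_mul] at hsum
  · refine (mul_eq_zero.1 hsum).resolve_left ?_
    refine Nat.cast_ne_zero.2 (Finset.card_pos.2 ⟨τ, ?_⟩).ne'
    simp only [Finset.mem_filter, Finset.mem_univ, true_and, and_true]
    intro a
    exact (hx_iff _ _).2 (Equiv.Perm.sameCycle_apply_left.2 (Equiv.Perm.SameCycle.refl _ _))
  · intro σ hσ
    obtain ⟨c, hc⟩ := isConj_iff.1 (isConj_of_sameCycle_setoid_eq (Finset.mem_filter.1 hσ).2)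
    rw [← hc, hu]
  · intro σ hσ
    simp only [Finset.mem_filter, Finset.mem_univ, true_and] at hσ
    refine ih _ (lt_of_le_of_ne ?_ hσ.2) σ rfl
    intro a b hab
    exact (hx_iff a b).1 (eq_of_sameCycle hσ.1 hab)

/-! ### Generalized characters and the internal product -/

theorem ch_sub {K : Type*} [Field K] {d : ℕ} (u v : Equiv.Perm (Fin d) → K) :
    ch (u - v) = ch u - ch v := by
  simp [ch, sub_smul, smul_sub]

theorem isClassFun_of_mem_genChar {K : Type*} [Field K] {d : ℕ} {u : Equiv.Perm (Fin d) → K}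
    (hu : u ∈ genChar K d) : IsClassFun u := by
  induction hu using AddSubgroup.closure_induction with
  | mem u hu =>
    obtain ⟨n, ρ, rfl⟩ := hu
    exact ρ.char_conj
  | zero => intro g h; rfl
  | add u v _ _ hu hv => intro g h; simp [hu g h, hv g h]
  | neg u _ hu => intro g h; simp [hu g h]

theorem ch_injOn_genChar {K : Type*} [Field K] [CharZero K] (d : ℕ) :
    Set.InjOn (ch (d := d)) (genChar K d : Set (Equiv.Perm (Fin d) → K)) := by
  intro u hu v hv h
  refine sub_eq_zero.1 (eq_zero_of_ch_eq_zero
    (isClassFun_of_mem_genChar ((genChar K d).sub_mem hu hv)) ?_)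
  rw [ch_sub, h, sub_self]

/-- By injectivity, the preimages chosen in `internalMul` are `u` and `v` themselves. -/
theorem internalMul_ch {K : Type*} [Field K] [CharZero K] {d : ℕ} {u v : Equiv.Perm (Fin d) → K}
    (hu : u ∈ genChar K d) (hv : v ∈ genChar K d) :
    internalMul d (ch u) (ch v) = ch (u * v) := by
  rw [internalMul, (ch_injOn_genChar d).leftInvOn_invFunOn hu,
    (ch_injOn_genChar d).leftInvOn_invFunOn hv]

/-- A basis transports `ρ` to a coordinate space, and the trace is unchanged by conjugation. -/
theorem character_mem_genChar {K V : Type*} [Field K] [AddCommGroup V] [Module K V]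
    [FiniteDimensional K V] {d : ℕ} (ρ : Representation K (Equiv.Perm (Fin d)) V) :
    ρ.character ∈ genChar K d := by
  refine AddSubgroup.subset_closure ⟨Module.finrank K V, ?_⟩
  let e : V ≃ₗ[K] (Fin (Module.finrank K V) → K) := (Module.finBasis K V).equivFun
  refine ⟨(e.conjRingEquiv : _ →* _).comp ρ, ?_⟩
  funext g
  exact (LinearMap.trace_conj' (ρ g) e).symm

theorem one_mem_genChar (K : Type*) [Field K] (d : ℕ) :
    (1 : Equiv.Perm (Fin d) → K) ∈ genChar K d := by
  convert character_mem_genChar (Representation.trivial K (Equiv.Perm (Fin d)) K)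
  funext g
  simp [Representation.character, Representation.trivial]

theorem mul_mem_genChar {K : Type*} [Field K] {d : ℕ} {u v : Equiv.Perm (Fin d) → K}
    (hu : u ∈ genChar K d) (hv : v ∈ genChar K d) : u * v ∈ genChar K d := by
  induction hu using AddSubgroup.closure_induction with
  | mem u hu =>
    obtain ⟨n, ρ, rfl⟩ := hu
    induction hv using AddSubgroup.closure_induction with
    | mem v hv =>
      obtain ⟨m, τ, rfl⟩ := hv
      rw [← Representation.char_tensor]
      exact character_mem_genChar _
    | zero => rw [mul_zero]; exact zero_mem _
    | add v w _ _ hv hw => rw [mul_add]; exact add_mem hv hw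
    | neg v _ hv => rw [mul_neg]; exact neg_mem hv
  | zero => rw [zero_mul]; exact zero_mem _
  | add u w _ _ hu hw => rw [add_mul]; exact add_mem hu hw
  | neg u _ hu => rw [neg_mul]; exact neg_mem hu

/-- The internal product of characteristics is the characteristic of the product. -/
theorem internalProd_ch {K : Type*} [Field K] [CharZero K] {d k : ℕ}
    {u : Fin k → Equiv.Perm (Fin d) → K} (hu : ∀ m, u m ∈ genChar K d) :
    internalProd d (fun m => ch (u m)) = ch (∏ m, u m) := by
  -- Membership is carried along because the inductive step needs the tail product to be a
  -- generalized character.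
  suffices H : ∏ m, u m ∈ genChar K d ∧ internalProd d (fun m => ch (u m)) = ch (∏ m, u m) from
    H.2
  induction k with
  | zero => exact ⟨by simpa using one_mem_genChar K d, by simp [internalProd]⟩
  | succ k ih =>
    obtain ⟨h1, h2⟩ := ih fun m => hu m.succ
    rw [Fin.prod_univ_succ]
    refine ⟨mul_mem_genChar (hu 0) h1, ?_⟩
    rw [← internalMul_ch (hu 0) h1, ← h2, internalProd, internalProd, List.ofFn_succ,
      List.foldr_cons]

/-! ### Induced characters and cyclic indices -/

section Induced

variable {G K : Type*} [Group G] [Field K] {W : Subgroup G} {I : Set G}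

/-- This cocycle identity underlies the multiplicativity of `indMatrix`, the action on transversals
and the product rule for β. -/
theorem equiv_mul_mul (hI : Subgroup.IsComplement I (W : Set G)) (g h i : G) :
    hI.equiv (g * h * i) = ((hI.equiv (g * (hI.equiv (h * i)).1)).1,
      (show W from (hI.equiv (g * (hI.equiv (h * i)).1)).2) *
        (show W from (hI.equiv (h * i)).2)) := by
  conv_lhs => rw [mul_assoc, ← hI.equiv_fst_mul_equiv_snd (h * i), ← mul_assoc]
  exact hI.equiv_mul_right _ _

theorem equiv_one_mul (hI : Subgroup.IsComplement I (W : Set G)) (i : I) :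
    hI.equiv (1 * (i : G)) = (i, (1 : W)) := by
  rw [← Equiv.eq_symm_apply, Subgroup.IsComplement.equiv_symm_apply]
  simp

/-- The matrix representation of `G` induced from a one-dimensional character `χ` of `W`, with
respect to the basis indexed by a left transversal `I`. -/
def indMatrix [Fintype I] [DecidableEq I] (hI : Subgroup.IsComplement I (W : Set G)) (χ : W →* Kˣ) :
    G →* Matrix I I K where
  toFun g := Matrix.of fun j i =>
    if (hI.equiv (g * (i : G))).1 = j then (χ (hI.equiv (g * (i : G))).2 : K) else 0
  map_one' := by
    ext j i
    rw [Matrix.of_apply, equiv_one_mul, map_one, Matrix.one_apply]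
    simp [eq_comm]
  map_mul' g h := by
    ext j i
    rw [Matrix.mul_apply, Finset.sum_eq_single (hI.equiv (h * (i : G))).1]
    · simp only [Matrix.of_apply]
      rw [equiv_mul_mul]
      split_ifs <;> simp_all
    · intro l _ hl
      simp [Matrix.of_apply, hl.symm]
    · simp

open Classical in
/-- The character of `G` induced from a one-dimensional character `χ` of `W`. -/
def indChar [Fintype I] (hI : Subgroup.IsComplement I (W : Set G)) (χ : W →* Kˣ) (g : G) : K :=
  ∑ i : I, if (hI.equiv (g * (i : G))).1 = i then (χ (hI.equiv (g * (i : G))).2 : K) else 0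

theorem equiv_mul_fst_eq_iff (hI : Subgroup.IsComplement I (W : Set G)) (g : G) (i : I) :
    (hI.equiv (g * (i : G))).1 = i ↔ (i : G)⁻¹ * g * i ∈ W := by
  constructor
  · intro h
    have := hI.equiv_snd_eq_inv_mul (g * (i : G))
    rw [h, ← mul_assoc] at this
    rw [← this]
    exact (hI.equiv (g * (i : G))).2.2
  · intro h
    have : hI.equiv (g * (i : G)) = (i, (⟨_, h⟩ : W)) := by
      rw [← Equiv.eq_symm_apply, Subgroup.IsComplement.equiv_symm_apply]
      simp [mul_assoc]
    rw [this]

open Classical in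
/-- The extension by zero of a one-dimensional character of a subgroup. -/
def extendZero (χ : W →* Kˣ) (g : G) : K := if h : g ∈ W then (χ ⟨g, h⟩ : K) else 0

-- This turns the diagonal entries of the induced matrices into Frobenius's formula, whose terms can
-- be reindexed by conjugation.
open Classical in
theorem ite_equiv_mul_fst_eq (hI : Subgroup.IsComplement I (W : Set G)) (χ : W →* Kˣ) (g : G)
    (i : I) :
    (if (hI.equiv (g * (i : G))).1 = i then (χ (hI.equiv (g * (i : G))).2 : K) else 0) =
      extendZero χ ((i : G)⁻¹ * g * i) := by
  rw [extendZero]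
  by_cases h : (hI.equiv (g * (i : G))).1 = i
  · rw [if_pos h, dif_pos ((equiv_mul_fst_eq_iff hI g i).1 h)]
    congr 2
    refine Subtype.ext ?_
    have h' := hI.equiv_snd_eq_inv_mul (g * (i : G))
    rw [h, ← mul_assoc] at h'
    exact h'
  · rw [if_neg h, dif_neg (mt (equiv_mul_fst_eq_iff hI g i).2 h)]

end Induced

section IndChar

variable {K : Type*} [Field K] {d : ℕ} {W : Subgroup (Equiv.Perm (Fin d))}
  {I : Set (Equiv.Perm (Fin d))} [Fintype I]

theorem indChar_mem_genChar (hI : Subgroup.IsComplement I (W : Set (Equiv.Perm (Fin d))))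
    (χ : W →* Kˣ) : indChar hI χ ∈ genChar K d := by
  classical
  convert character_mem_genChar
    ((Matrix.toLinAlgEquiv' : Matrix I I K ≃ₐ[K] _).toMonoidHom.comp (indMatrix hI χ) :
      Representation K (Equiv.Perm (Fin d)) (I → K))
  funext g
  rw [Representation.character]
  refine Eq.trans ?_ (Matrix.trace_toLin'_eq (indMatrix hI χ g)).symm
  refine Finset.sum_congr rfl fun i _ => ?_
  simp only [Matrix.diag, indMatrix, MonoidHom.coe_mk, OneHom.coe_mk, Matrix.of_apply]
  congr!

theorem cycleMonomial_conj (K : Type*) [Field K] (σ τ : Equiv.Perm (Fin d)) :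
    cycleMonomial K (τ * σ * τ⁻¹) = cycleMonomial K σ :=
  (cycleMonomial_eq_of_isConj K (isConj_iff.2 ⟨τ, rfl⟩)).symm

theorem sum_extendZero_smul (χ : W →* Kˣ) [Fintype W] :
    ∑ σ, extendZero χ σ • cycleMonomial K σ =
      ∑ σ : W, (χ σ : K) • cycleMonomial K (σ : Equiv.Perm (Fin d)) := by
  classical
  rw [← Finset.sum_subset (Finset.subset_univ (Finset.univ.filter fun σ => σ ∈ W))]
  · rw [← Finset.sum_subtype_eq_sum_filter, Finset.subtype_univ]
    refine Finset.sum_congr (by ext; simp) fun σ _ => ?_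
    rw [extendZero, dif_pos σ.2]
  · intro σ _ hσ
    rw [extendZero, dif_neg (by simpa using hσ), zero_smul]

/-- The cyclic index of `χ` is the characteristic of the character induced by `χ`. -/
theorem cycleIndex_eq_ch [CharZero K]
    (hI : Subgroup.IsComplement I (W : Set (Equiv.Perm (Fin d)))) (χ : W →* Kˣ) :
    cycleIndex χ = ch (indChar hI χ) := by
  classical
  have hcard : Nat.card I * Nat.card W = d.factorial := by
    have := Nat.card_congr hI.equiv
    rw [Nat.card_prod, Nat.card_eq_fintype_card (α := Equiv.Perm (Fin d)), Fintype.card_perm,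
      Fintype.card_fin] at this
    exact this.symm
  have hI0 : (Nat.card I : K) ≠ 0 := by
    intro h
    rw [Nat.cast_eq_zero.1 h, zero_mul] at hcard
    exact d.factorial_ne_zero hcard.symm
  have hsum : ∑ σ, indChar hI χ σ • cycleMonomial K σ =
      (Nat.card I : K) • ∑ σ : W, (χ σ : K) • cycleMonomial K (σ : Equiv.Perm (Fin d)) := by
    simp only [indChar, ite_equiv_mul_fst_eq, Finset.sum_smul]
    rw [Finset.sum_comm, Finset.sum_congr rfl
      (g := fun _ => ∑ σ : W, (χ σ : K) • cycleMonomial K (σ : Equiv.Perm (Fin d))),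
      Finset.sum_const, Finset.card_univ, ← Nat.card_eq_fintype_card, Nat.cast_smul_eq_nsmul]
    intro i _
    rw [← sum_extendZero_smul]
    -- Cycle monomials are class functions, so conjugating by `i⁻¹` makes every `i` contribute the
    -- same sum; |I||W| = d! then fixes the constant.
    refine Fintype.sum_equiv (MulAut.conj (i : Equiv.Perm (Fin d))⁻¹).toEquiv _ _ fun σ => ?_
    simp only [MulEquiv.toEquiv_eq_coe, MulEquiv.coe_toEquiv, MulAut.conj_apply]
    rw [cycleMonomial_conj, inv_inv]
  rw [ch, hsum, smul_smul, ← hcard, Nat.cast_mul, mul_inv, mul_right_comm, inv_mul_cancel₀ hI0,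
    one_mul, cycleIndex]

end IndChar

/-! ### Products of induced characters, orbit by orbit -/

section Product

variable {K : Type*} [Field K] {d k : ℕ} {W : Fin k → Subgroup (Equiv.Perm (Fin d))}
  {I : Fin k → Set (Equiv.Perm (Fin d))}
  (hI : ∀ m, Subgroup.IsComplement (I m) (W m : Set (Equiv.Perm (Fin d)))) (χ : ∀ m, W m →* Kˣ)

-- Expanding the product of sums over transversals, a term survives only if ζ fixes every component
-- of `i`.
open Classical in
theorem prod_indChar_apply [∀ m, Fintype (I m)] (ζ : Equiv.Perm (Fin d)) :
    (∏ m, indChar (hI m) (χ m)) ζ =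
      ∑ i : ∀ m, I m, if act hI ζ i = i then (beta hI χ i ζ : K) else 0 := by
  rw [Finset.prod_apply]
  simp only [indChar]
  rw [Finset.prod_univ_sum, Fintype.piFinset_univ]
  refine Finset.sum_congr rfl fun i _ => ?_
  by_cases h : act hI ζ i = i
  · rw [if_pos h, beta, Units.coe_prod]
    exact Finset.prod_congr rfl fun m _ => if_pos (congrFun h m)
  · obtain ⟨m, hm⟩ := Function.ne_iff.1 h
    rw [if_neg h]
    exact Finset.prod_eq_zero (Finset.mem_univ m) (if_neg hm)

theorem act_one (i : ∀ m, I m) : act hI 1 i = i := by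
  funext m
  rw [act, equiv_one_mul]

theorem act_mul (ζ η : Equiv.Perm (Fin d)) (i : ∀ m, I m) :
    act hI (ζ * η) i = act hI ζ (act hI η i) := by
  funext m
  rw [act, equiv_mul_mul]
  rfl

theorem beta_mul (ζ η : Equiv.Perm (Fin d)) (i : ∀ m, I m) :
    beta hI χ i (ζ * η) = beta hI χ (act hI η i) ζ * beta hI χ i η := by
  rw [beta, beta, beta, ← Finset.prod_mul_distrib]
  refine Finset.prod_congr rfl fun m _ => ?_
  rw [equiv_mul_mul, map_mul]
  rfl

/-- The action of `S_d` on a product of left transversals. -/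
abbrev transversalAction : MulAction (Equiv.Perm (Fin d)) (∀ m, I m) where
  smul := act hI
  one_smul := act_one hI
  mul_smul := act_mul hI

theorem act_eq_self_iff (ζ : Equiv.Perm (Fin d)) (i : ∀ m, I m) :
    act hI ζ i = i ↔ ζ ∈ stab W i := by
  rw [funext_iff, stab, Subgroup.mem_iInf]
  refine forall_congr' fun m => ?_
  rw [act, equiv_mul_fst_eq_iff]
  constructor
  · intro h
    exact ⟨_, h, by simp [mul_assoc]⟩
  · rintro ⟨w, hw, rfl⟩
    simpa [mul_assoc] using hw

/-- Apply the cocycle rule to ηζ = (ηζη⁻¹)η in both ways; the factor β_i(η) cancels because the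
values commute. -/
theorem beta_conj {ζ : Equiv.Perm (Fin d)} {i : ∀ m, I m} (h : act hI ζ i = i)
    (η : Equiv.Perm (Fin d)) :
    beta hI χ (act hI η i) (η * ζ * η⁻¹) = beta hI χ i ζ := by
  have h1 := beta_mul hI χ (η * ζ * η⁻¹) η i
  rw [inv_mul_cancel_right, beta_mul, h, mul_comm] at h1
  exact (mul_right_cancel h1.symm)

-- The contribution of `i` depends only on its orbit: conjugation by η carries one sum to the other.
open Classical in
theorem sum_stab_smul_act (i : ∀ m, I m) (η : Equiv.Perm (Fin d)) :
    ∑ ζ, (if act hI ζ (act hI η i) = act hI η i then (beta hI χ (act hI η i) ζ : K) else 0) •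
        cycleMonomial K ζ =
      ∑ ζ, (if act hI ζ i = i then (beta hI χ i ζ : K) else 0) • cycleMonomial K ζ := by
  symm
  refine Fintype.sum_equiv (MulAut.conj η).toEquiv _ _ fun ζ => ?_
  change _ = (if act hI (η * ζ * η⁻¹) (act hI η i) = act hI η i then
    (beta hI χ (act hI η i) (η * ζ * η⁻¹) : K) else 0) • cycleMonomial K (η * ζ * η⁻¹)
  rw [cycleMonomial_conj]
  have hiff : act hI (η * ζ * η⁻¹) (act hI η i) = act hI η i ↔ act hI ζ i = i := by
    rw [← act_mul, inv_mul_cancel_right, act_mul]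
    exact (@MulAction.injective _ _ _ (transversalAction hI) η).eq_iff
  by_cases h : act hI ζ i = i
  · rw [if_pos h, if_pos (hiff.2 h), beta_conj hI χ h]
  · rw [if_neg h, if_neg (mt hiff.1 h)]

open Classical in
theorem sum_stab_smul_eq [CharZero K] (ω : ∀ m, I m) :
    ∑ ζ, (if act hI ζ ω = ω then (beta hI χ ω ζ : K) else 0) • cycleMonomial K ζ =
      (Nat.card (stab W ω) : K) • cycleIndex (psi hI χ ω) := by
  rw [cycleIndex, smul_inv_smul₀ (Nat.cast_ne_zero.2 Nat.card_pos.ne'), ← sum_extendZero_smul]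
  refine Finset.sum_congr rfl fun ζ _ => ?_
  congr 1
  simp only [extendZero, act_eq_self_iff]
  split_ifs <;> rfl

/-- The characteristic of a product of induced characters, as a sum over the orbits of `S_d` in
the product of the transversals. -/
theorem ch_prod_indChar [CharZero K] [∀ m, Fintype (I m)] {T : Set (∀ m, I m)} [Fintype T]
    (hT : IsRepSystem hI T) :
    ch (∏ m, indChar (hI m) (χ m)) = ∑ ω : T, cycleIndex (psi hI χ (ω : ∀ m, I m)) := by
  classical
  let _ := transversalAction hI
  have hd : (d.factorial : K) ≠ 0 := by exact_mod_cast d.factorial_ne_zero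
  choose r hr hru using hT
  rw [ch, inv_smul_eq_iff₀ hd, Finset.smul_sum]
  simp only [prod_indChar_apply, Finset.sum_smul]
  -- The points are grouped by the representatives of their orbits.
  rw [Finset.sum_comm, ← Finset.sum_fiberwise Finset.univ (fun i => (⟨r i, (hr i).1⟩ : T))]
  refine Finset.sum_congr rfl fun ω _ => ?_
  rw [Finset.sum_congr rfl (g := fun _ =>
    ∑ ζ, (if act hI ζ ω = ω then (beta hI χ ω ζ : K) else 0) • cycleMonomial K ζ), Finset.sum_const,
    sum_stab_smul_eq, ← Nat.cast_smul_eq_nsmul K, smul_smul, ← Nat.cast_mul]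
  -- Orbit–stabilizer: orbit size times |W_ω| is d!, which cancels the normalizations.
  · congr 2
    have h1 : MulAction.stabilizer (Equiv.Perm (Fin d)) (ω : ∀ m, I m) = stab W (ω : ∀ m, I m) := by
      ext ζ
      exact act_eq_self_iff hI ζ _
    have h2 : (Finset.univ.filter fun i => (⟨r i, (hr i).1⟩ : T) = ω) =
        (MulAction.orbit (Equiv.Perm (Fin d)) (ω : ∀ m, I m)).toFinset := by
      ext i
      rw [Finset.mem_filter, Set.mem_toFinset, Subtype.ext_iff]
      constructor
      · rintro ⟨-, h⟩
        obtain ⟨ζ, hζ⟩ := (hr i).2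
        exact ⟨ζ, h ▸ hζ⟩
      · rintro ⟨ζ, hζ⟩
        exact ⟨Finset.mem_univ _, (hru i _ ⟨ω.2, ζ, hζ⟩).symm⟩
    rw [h2, Set.toFinset_card, ← h1, Nat.card_eq_fintype_card,
      MulAction.card_orbit_mul_card_stabilizer_eq_card_group, Fintype.card_perm, Fintype.card_fin]
  · intro i hi
    obtain ⟨ζ, hζ⟩ := (hr i).2
    have hri : r i = ω := congrArg Subtype.val (Finset.mem_filter.1 hi).2
    rw [hri] at hζ
    rw [← hζ]
    exact sum_stab_smul_act hI χ _ ζ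

end Product

/-! ### Orbits of a normal subgroup and weighted Burnside counting -/

section Orbits

variable {H X : Type*} [Group H] [MulAction H X]

/-- An orbit of `H` contains the maximal number of orbits of a normal subgroup `N` if and only if
the stabilizers of its points lie in `N`. -/
theorem ncard_orbits_eq_index_iff [Finite H] (N : Subgroup H) [N.Normal] (x : X) :
    {P | P ⊆ MulAction.orbit H x ∧ ∃ y, P = MulAction.orbit N y}.ncard = N.index ↔
      MulAction.stabilizer H x ≤ N := by
  have key : ∀ g h : H, MulAction.orbit N (g • x) = MulAction.orbit N (h • x) ↔
      ∃ n ∈ N, n • h • x = g • x := by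
    intro g h
    rw [MulAction.orbit_eq_iff]
    constructor
    · rintro ⟨n, hn⟩
      exact ⟨n, n.2, hn⟩
    · rintro ⟨n, hn, h⟩
      exact ⟨⟨n, hn⟩, h⟩
  -- Normality makes gN ↦ N(gx) well defined. It maps onto the N-orbits in Hx, so by finiteness
  -- their number equals the index exactly when the map is injective.
  let f : H ⧸ N → Set X := Quotient.lift (fun g : H => MulAction.orbit N (g • x)) (by
    intro g h hgh
    have hgh : g⁻¹ * h ∈ N := QuotientGroup.leftRel_apply.1 hgh
    refine (key g h).2 ⟨g * h⁻¹, ?_, by simp [mul_smul]⟩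
    have := N.inv_mem (‹N.Normal›.conj_mem _ hgh g)
    simpa using this)
  have hf : ∀ g : H, f (g : H ⧸ N) = MulAction.orbit N (g • x) := fun _ => rfl
  have hS : {P | P ⊆ MulAction.orbit H x ∧ ∃ y, P = MulAction.orbit N y} = f '' Set.univ := by
    ext P
    simp only [Set.mem_ofPred_eq, Set.image_univ, Set.mem_range]
    constructor
    · rintro ⟨hP, y, rfl⟩
      obtain ⟨g, rfl⟩ := hP (MulAction.mem_orbit_self y)
      exact ⟨(g : H ⧸ N), rfl⟩
    · rintro ⟨q, rfl⟩
      induction q using QuotientGroup.induction_on with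
      | H g =>
        refine ⟨?_, g • x, rfl⟩
        rintro _ ⟨n, rfl⟩
        exact ⟨n * g, mul_smul _ _ _⟩
  rw [hS, Subgroup.index, ← Set.ncard_univ, Set.ncard_image_iff]
  constructor
  · intro hinj s hs
    have h1 : f (s : H ⧸ N) = f ((1 : H) : H ⧸ N) := by
      rw [hf, hf, one_smul, MulAction.mem_stabilizer_iff.1 hs]
    have h2 := hinj (Set.mem_univ _) (Set.mem_univ _) h1
    exact (QuotientGroup.eq_one_iff s).1 h2
  · intro hle p _ q _ hpq
    induction p using QuotientGroup.induction_on with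
    | H g =>
    induction q using QuotientGroup.induction_on with
    | H h =>
      rw [hf, hf, key] at hpq
      obtain ⟨n, hn, hnx⟩ := hpq
      rw [QuotientGroup.eq]
      have hs : g⁻¹ * n * h ∈ N := hle (by
        rw [MulAction.mem_stabilizer_iff, mul_smul, mul_smul, hnx, inv_smul_smul])
      have hc : h⁻¹ * n⁻¹ * h ∈ N := by
        simpa using ‹N.Normal›.conj_mem _ (N.inv_mem hn) h⁻¹
      simpa [mul_assoc] using N.mul_mem hs hc

variable {K : Type*} [Field K]

-- Orthogonality: a nontrivial homomorphism from a finite group to the units of a field has sum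
-- zero.
open Classical in
theorem sum_stabilizer [Fintype H] (ψ : H →* Kˣ) (x : X) :
    ∑ σ : H with σ • x = x, (ψ σ : K) =
      if MulAction.stabilizer H x ≤ ψ.ker then (Nat.card (MulAction.stabilizer H x) : K)
      else 0 := by
  let f : MulAction.stabilizer H x →* K :=
    (Units.coeHom K).comp (ψ.comp (MulAction.stabilizer H x).subtype)
  have hf : f = 1 ↔ MulAction.stabilizer H x ≤ ψ.ker := by
    rw [MonoidHom.ext_iff]
    constructor
    · intro h s hs
      exact Units.ext (h ⟨s, hs⟩)
    · intro h s
      have := h s.2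
      rw [MonoidHom.mem_ker] at this
      simp [f, this]
  have := sum_hom_units f
  simp only [hf, ← Nat.card_eq_fintype_card] at this
  push_cast at this
  rw [← this]
  exact Finset.sum_subtype (p := (· ∈ MulAction.stabilizer H x)) _ (by simp)
    (fun σ => (ψ σ : K))

open Classical in
/-- A weighted form of Burnside's lemma. -/
theorem sum_mul_card_fixed [Fintype H] (ψ : H →* Kˣ) (s : Finset X)
    (hs : ∀ (h : H), ∀ x ∈ s, h • x ∈ s) :
    ∑ σ : H, (ψ σ : K) * ((s.filter fun x => σ • x = x).card : K) =
      Nat.card H * (((s.filter fun x => MulAction.stabilizer H x ≤ ψ.ker).image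
        (MulAction.orbit H)).card : K) := by
  have h1 : ∑ σ : H, (ψ σ : K) * ((s.filter fun x => σ • x = x).card : K) =
      ∑ x ∈ s, ∑ σ : H with σ • x = x, (ψ σ : K) := by
    simp only [Finset.card_filter, Nat.cast_sum, Finset.mul_sum, Finset.sum_filter]
    rw [Finset.sum_comm]
    simp
  rw [h1]
  simp only [sum_stabilizer]
  rw [← Finset.sum_filter, ← Nat.cast_sum, ← Nat.cast_mul]
  congr 1
  -- Each surviving orbit contributes |orbit| · |stabilizer| = |H|.
  rw [← Finset.sum_fiberwise_of_maps_to
      (fun x hx => Finset.mem_image_of_mem (MulAction.orbit H) hx),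
    Finset.sum_congr rfl (g := fun _ => Nat.card H), Finset.sum_const, smul_eq_mul, mul_comm]
  intro O hO
  obtain ⟨x, hx, rfl⟩ := Finset.mem_image.1 hO
  obtain ⟨hxs, hxψ⟩ := Finset.mem_filter.1 hx
  have hfin : (MulAction.orbit H x).Finite := Set.finite_range _
  have hcard : ∀ y, MulAction.orbit H y = MulAction.orbit H x →
      (MulAction.orbit H x).ncard * Nat.card (MulAction.stabilizer H y) = Nat.card H := by
    intro y hy
    rw [← hy, ← MulAction.index_stabilizer, Subgroup.index_mul_card]
  have hpos : 0 < (MulAction.orbit H x).ncard :=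
    (Set.ncard_pos hfin).2 ⟨x, MulAction.mem_orbit_self x⟩
  have hfilter : ((s.filter fun x => MulAction.stabilizer H x ≤ ψ.ker).filter
      fun y => MulAction.orbit H y = MulAction.orbit H x) = hfin.toFinset := by
    ext y
    rw [Finset.mem_filter, Finset.mem_filter, Set.Finite.mem_toFinset, MulAction.orbit_eq_iff]
    constructor
    · exact fun h => h.2
    · rintro ⟨h, rfl⟩
      refine ⟨⟨hs h x hxs, ?_⟩, h, rfl⟩
      intro g hg
      have hg' : h⁻¹ * g * h ∈ MulAction.stabilizer H x := by
        have hg : g • h • x = h • x := hg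
        rw [MulAction.mem_stabilizer_iff, mul_smul, mul_smul, hg, inv_smul_smul]
      -- Stabilizers along an orbit are conjugate and the kernel is normal, so whole orbits survive
      -- or vanish together.
      have := ψ.normal_ker.conj_mem _ (hxψ hg') h
      simpa [mul_assoc] using this
  rw [Finset.sum_congr rfl (g := fun _ => Nat.card (MulAction.stabilizer H x)), Finset.sum_const,
    hfilter, ← Set.ncard_eq_toFinset_card _ hfin, smul_eq_mul, hcard x rfl]
  intro y hy
  exact Nat.eq_of_mul_eq_mul_left hpos ((hcard y (Finset.mem_filter.1 hy).2).trans
    (hcard x rfl).symm)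

end Orbits

/-! ### Inventories of orbits of words -/

/-- The action of `S_d` on words of length `d` by permuting the components. -/
abbrev wordAction (d : ℕ) : MulAction (Equiv.Perm (Fin d)) (Fin d → ℕ) where
  smul σ x := fun a => x (σ⁻¹ a)
  one_smul _ := rfl
  mul_smul σ τ x := by
    funext a
    change x ((σ * τ)⁻¹ a) = x (τ⁻¹ (σ⁻¹ a))
    rw [mul_inv_rev, Equiv.Perm.mul_apply]

theorem orbitWeight_wordOrbit {d : ℕ} (H : Subgroup (Equiv.Perm (Fin d))) (x : Fin d → ℕ) :
    orbitWeight (wordOrbit H x) = content x := by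
  have h : (wordOrbit H x).Nonempty := ⟨_, 1, rfl⟩
  rw [orbitWeight, dif_pos h]
  obtain ⟨σ, hσ⟩ := h.some_mem
  rw [← hσ]
  exact content_comp_perm x _

section MaxOrbits

variable {K : Type*} [Field K] {d : ℕ} {H : Subgroup (Equiv.Perm (Fin d))}

/-- Each such orbit is generated by one of the finitely many words of content `n`. -/
theorem finite_maxOrbits_orbitWeight_eq (ψ : H →* Kˣ) (n : ℕ →₀ ℕ) :
    Finite {O : maxOrbits ψ // orbitWeight (O : Set (Fin d → ℕ)) = n} := by
  have hfin : {O : Set (Fin d → ℕ) | O ∈ maxOrbits ψ ∧ orbitWeight O = n}.Finite := by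
    refine ((words d n).finite_toSet.image (wordOrbit H)).subset ?_
    rintro O ⟨⟨⟨x, rfl⟩, -⟩, hn⟩
    exact ⟨x, mem_words.2 (by rw [← hn, orbitWeight_wordOrbit]), rfl⟩
  have := hfin.to_subtype
  exact Finite.of_injective (fun O => (⟨O.1.1, O.1.2, O.2⟩ :
    {O : Set (Fin d → ℕ) | O ∈ maxOrbits ψ ∧ orbitWeight O = n}))
    fun O P h => Subtype.ext (Subtype.ext (Subtype.ext_iff.1 h :))

/-- The generalized cyclic index of `ψ` is the inventory of the `H`-orbits that contain the
maximal number of orbits of the kernel of `ψ`. -/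
theorem coeff_cycleIndex [CharZero K] (ψ : H →* Kˣ) (n : ℕ →₀ ℕ) :
    MvPowerSeries.coeff n (cycleIndex ψ) =
      (Nat.card {O : maxOrbits ψ // orbitWeight (O : Set (Fin d → ℕ)) = n} : K) := by
  classical
  let _ := wordAction d
  have hfix : ∀ (σ : H) (x : Fin d → ℕ),
      (∀ a, x ((σ : Equiv.Perm (Fin d)) a) = x a) ↔ σ • x = x := by
    intro σ x
    rw [funext_iff]
    constructor
    · intro h a
      have := h ((σ : Equiv.Perm (Fin d))⁻¹ a)
      rw [← Equiv.Perm.mul_apply, mul_inv_cancel, Equiv.Perm.one_apply] at this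
      exact this.symm
    · intro h a
      have : x ((σ : Equiv.Perm (Fin d))⁻¹ ((σ : Equiv.Perm (Fin d)) a)) = _ := h _
      rw [← Equiv.Perm.mul_apply, inv_mul_cancel, Equiv.Perm.one_apply] at this
      exact this.symm
  -- The kernel appears as a subgroup of S_d in `maxOrbits` and as a subgroup of `H` in the orbit
  -- criterion; the orbits agree.
  have hker : ∀ y, wordOrbit (ψ.ker.map H.subtype) y = MulAction.orbit ψ.ker y := by
    intro y
    ext z
    constructor
    · rintro ⟨⟨_, σ, hσ, rfl⟩, rfl⟩
      exact ⟨⟨σ, hσ⟩, rfl⟩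
    · rintro ⟨⟨σ, hσ⟩, rfl⟩
      exact ⟨⟨_, σ, hσ, rfl⟩, rfl⟩
  have hmax : ∀ x, wordOrbit H x ∈ maxOrbits ψ ↔ MulAction.stabilizer H x ≤ ψ.ker := by
    intro x
    rw [← ncard_orbits_eq_index_iff ψ.ker x, maxOrbits]
    simp only [hker, Set.mem_ofPred_eq]
    exact and_iff_right ⟨x, rfl⟩
  have hinv : ∀ (h : H), ∀ x ∈ words d n, h • x ∈ words d n := by
    intro h x hx
    rw [mem_words] at hx ⊢
    rw [← hx]
    exact content_comp_perm x _
  have hset : {O : Set (Fin d → ℕ) | O ∈ maxOrbits ψ ∧ orbitWeight O = n} =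
      (((words d n).filter fun x => MulAction.stabilizer H x ≤ ψ.ker).image
        (MulAction.orbit H) : Finset (Set (Fin d → ℕ))) := by
    ext O
    rw [Finset.mem_coe, Finset.mem_image]
    constructor
    · rintro ⟨hO, hn⟩
      obtain ⟨x, rfl⟩ := hO.1
      refine ⟨x, Finset.mem_filter.2 ⟨?_, (hmax x).1 hO⟩, rfl⟩
      rw [mem_words, ← hn, orbitWeight_wordOrbit]
    · rintro ⟨x, hx, rfl⟩
      obtain ⟨hx, hψ⟩ := Finset.mem_filter.1 hx
      exact ⟨(hmax x).2 hψ, (orbitWeight_wordOrbit H x).trans (mem_words.1 hx)⟩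
  have hcard : Nat.card {O : maxOrbits ψ // orbitWeight (O : Set (Fin d → ℕ)) = n} =
      (((words d n).filter fun x => MulAction.stabilizer H x ≤ ψ.ker).image
        (MulAction.orbit H)).card := by
    rw [← Set.ncard_coe_finset, ← hset]
    exact Nat.card_congr (Equiv.subtypeSubtypeEquivSubtypeInter (· ∈ maxOrbits ψ)
      (orbitWeight · = n))
  have hH : (Nat.card H : K) ≠ 0 := Nat.cast_ne_zero.2 Nat.card_pos.ne'
  rw [cycleIndex, map_smul, map_sum, smul_eq_mul, inv_mul_eq_iff_eq_mul₀ hH, hcard,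
    ← sum_mul_card_fixed ψ _ hinv]
  refine Finset.sum_congr (by ext; simp) fun σ _ => ?_
  rw [map_smul, smul_eq_mul, coeff_cycleMonomial]
  congr 3
  ext x
  simp only [Finset.mem_filter, hfix]

end MaxOrbits

/-- Elements of a sigma type with a property, as a sigma type of elements with a property. -/
def subtypeSigmaEquivSigma {α : Type*} {β : α → Type*} (p : (Σ a, β a) → Prop) :
    {u : Σ a, β a // p u} ≃ Σ a, {b : β a // p ⟨a, b⟩} where
  toFun u := ⟨u.1.1, u.1.2, u.2⟩
  invFun u := ⟨⟨u.1, u.2.1⟩, u.2.2⟩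
  left_inv _ := rfl
  right_inv _ := rfl

end

end Redfield

/-! ### The inventory theorem -/

theorem theorem4p1p2 {K : Type*} [Field K] [IsAlgClosed K] [CharZero K] (d k : ℕ)
    (W : Fin k → Subgroup (Equiv.Perm (Fin d))) (χ : ∀ m, W m →* Kˣ)
    (I : Fin k → Set (Equiv.Perm (Fin d)))
    (hI : ∀ m, Subgroup.IsComplement (I m) (W m : Set (Equiv.Perm (Fin d))))
    (T : Set (∀ m, I m)) (hT : Redfield.IsRepSystem hI T) :
    (∀ n : ℕ →₀ ℕ, {u : Redfield.U hI χ T | u.weight = n}.Finite) ∧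
      Redfield.internalProd d (fun m => Redfield.cycleIndex (χ m)) =
        Redfield.inventory K (fun u : Redfield.U hI χ T => u.weight) := by
  classical
  have hfin := fun (n : ℕ →₀ ℕ) (ω : T) =>
    Redfield.finite_maxOrbits_orbitWeight_eq (Redfield.psi hI χ (ω : ∀ m, I m)) n
  have e : ∀ n : ℕ →₀ ℕ, {u : Redfield.U hI χ T // u.weight = n} ≃ Σ ω : T,
      {O : Redfield.maxOrbits (Redfield.psi hI χ (ω : ∀ m, I m)) //
        Redfield.orbitWeight (O : Set (Fin d → ℕ)) = n} :=
    fun n => Redfield.subtypeSigmaEquivSigma fun u => Redfield.U.weight u = n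
  refine ⟨fun n => ?_, ?_⟩
  · have : Finite {u : Redfield.U hI χ T | u.weight = n} := Finite.of_equiv _ (e n).symm
    exact Set.toFinite {u : Redfield.U hI χ T | u.weight = n}
  · have hprod := Redfield.internalProd_ch
      fun m => Redfield.indChar_mem_genChar (hI m) (χ m)
    simp only [← Redfield.cycleIndex_eq_ch] at hprod
    rw [hprod, Redfield.ch_prod_indChar hI χ hT]
    ext n
    rw [map_sum, MvPowerSeries.coeff_apply (Redfield.inventory K _), Redfield.inventory,
      Nat.card_congr (e n), Nat.card_sigma, Nat.cast_sum]
    exact Finset.sum_congr rfl fun ω _ => Redfield.coeff_cycleIndex _ n
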